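/- Let $d\ge 1$, let $D\subset\mathbb{R}^d$ be a non-empty bounded convex open set (for instance one with piecewise $C^1$ boundary), and let $S\subset\mathbb{R}^d$ be the unit sphere with its rotation-invariant probability measure $ds$. For $x\in\partial D$ we say that the outward unit normal $n(x)$ is well defined if there is exactly one unit vector $e$ with $e\cdot(y-x)\le 0$ for all $y\in D$, and then $n(x)=e$. For $s\in S$ put $$\Gamma_\pm(s)=\{x\in\partial D:\ n(x)\text{ is well defined and } \pm s\cdot n(x)>0\}.$$ Let $H(s;D)=\{v\in L_2(D): s\cdot\nabla v\in L_2(D)\}$ with $\|v\|_{H(s;D)}^2=\|v\|_{L_2(D)}^2+\|s\cdot\nabla v\|_{L_2(D)}^2$, and let $H(D\times S)=\{v\in L_2(D\times S): s\cdot\nabla v\in L_2(D\times S)\}$ with $\|v\|_{H(D\times S)}^2=\|v\|_{L_2(D\times S)}^2+\|s\cdot\nabla v\|_{L_2(D\times S)}^2$, where $\nabla$ is the weak gradient in $x$. Let $H_{0,\Gamma_\pm(s)}(s;D)$ be the closure in $H(s;D)$ of $\{v\in C^1(\overline D): v=0\text{ on }\Gamma_\pm(s)\}$, and $H_{0,\pm}(D\times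 S)$ the closure in $H(D\times S)$ of $\{v\in C^1(\overline{D\times S}): v(x,s)=0\text{ for all } s\in S,\ x\in\Gamma_\pm(s)\}$. For $\sigma:D\times S\to\mathbb{R}$ let $$\mathcal{T}_s v=s\cdot\nabla v+\sigma(\cdot,s)v,\qquad \mathcal{T}_s^*v=\sigma(\cdot,s)v-s\cdot\nabla v,$$ and let $\mathcal{T},\mathcal{T}^*$ be the lifted operators given by $(\mathcal{T}v)(x,s)=s\cdot\nabla v(x,s)+\sigma(x,s)v(x,s)$ and $(\mathcal{T}^*v)(x,s)=\sigma(x,s)v(x,s)-s\cdot\nabla v(x,s)$. **Theorem.** For all real $m\ge 0$, $M$ and $L$ there are constants $c,C>0$, depending only on $m$, $M$ and $L$, such that the following holds for every $d\ge1$, every $D$ as above with $\operatorname{diam}(D)=L$, and every measurable $\sigma$ with $m\le\sigma\le M$ almost everywhere on $D\times S$ (for $0\le\sigma\in L_\infty(D\times S)$ one may take $m=\sigma_{\min}$ and $M=\sigma_{\max}$). 1. Call $s\in S$ admissible if $\sigma(\cdot,s)$ is measurable and $m\le\sigma(\cdot,s)\le M$ almost everywhere on $D$. Almost every $s\in S$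 is admissible, and if $\sigma$ is Borel measurable and the bounds hold everywhere on $D\times S$, then every $s\in S$ is admissible. 2. For every admissible $s\in S$, $$c\|v\|_{H(s;D)}\le\|\mathcal{T}_s^*v\|_{L_2(D)}\le C\|v\|_{H(s;D)}\qquad\text{for all }v\in H_{0,\Gamma_+(s)}(s;D),$$ $$c\|v\|_{H(s;D)}\le\|\mathcal{T}_sv\|_{L_2(D)}\le C\|v\|_{H(s;D)}\qquad\text{for all }v\in H_{0,\Gamma_-(s)}(s;D).$$ 3. Likewise $$c\|v\|_{H(D\times S)}\le\|\mathcal{T}^*v\|_{L_2(D\times S)}\le C\|v\|_{H(D\times S)}\qquad\text{for all }v\in H_{0,+}(D\times S),$$ $$c\|v\|_{H(D\times S)}\le\|\mathcal{T}v\|_{L_2(D\times S)}\le C\|v\|_{H(D\times S)}\qquad\text{for all }v\in H_{0,-}(D\times S).$$ -/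

import Mathlib

open MeasureTheory Metric Set
open scoped ENNReal ContDiff Manifold

noncomputable section

namespace Transport

/-- Space `ℝ^d` with its Euclidean norm, where `d = n + 1 ≥ 1`. -/
abbrev Space (n : ℕ) : Type := EuclideanSpace ℝ (Fin (n + 1))

/-- The unit sphere of directions in `ℝ^(n+1)`, a smooth `n`-dimensional manifold. -/
abbrev Sph (n : ℕ) : Type := sphere (0 : Space n) 1

/-- The rotation-invariant probability measure on the sphere (normalized surface measure). -/
def sphMeasure (n : ℕ) : Measure (Sph n) :=
  ((volume : Measure (Space n)).toSphere univ)⁻¹ • (volume : Measure (Space n)).toSphere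

instance (n : ℕ) : IsProbabilityMeasure (sphMeasure n) := by
  have : NeZero ((volume : Measure (Space n)).toSphere) := ⟨Measure.toSphere_ne_zero _⟩
  unfold sphMeasure
  infer_instance

variable {n : ℕ}

/-- Lebesgue measure on the spatial domain `D`. -/
abbrev domMeasure (D : Set (Space n)) : Measure (Space n) := volume.restrict D

/-- The product measure `dx ds` on the phase space `D × S`. -/
abbrev phaseMeasure (D : Set (Space n)) : Measure (Space n × Sph n) :=
  (volume.restrict D).prod (sphMeasure n)

/-- `e` is an outward unit normal of the convex set `D` at `x`: it is a unit vector and `D` lies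
in the half space through `x` that points away from `e`. -/
def IsOuterNormal (D : Set (Space n)) (x e : Space n) : Prop :=
  ‖e‖ = 1 ∧ ∀ y ∈ D, inner ℝ e (y - x) ≤ 0

/-- `e` is the outward unit normal `n(x)` of the convex set `D` at `x`: there is exactly one
outward unit normal, and it is `e`. -/
def IsNormalAt (D : Set (Space n)) (x e : Space n) : Prop :=
  ∀ e' : Space n, IsOuterNormal D x e' ↔ e' = e

/-- The outflow boundary `Γ₊(s)`: the boundary points at which the outward normal `n(x)` is well
defined and `s ⬝ n(x) > 0`. -/
def outflow (D : Set (Space n)) (s : Sph n) : Set (Space n) :=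
  {x ∈ frontier D | ∃ e, IsNormalAt D x e ∧ 0 < inner ℝ (s : Space n) e}

/-- The inflow boundary `Γ₋(s)`: the boundary points at which the outward normal `n(x)` is well
defined and `s ⬝ n(x) < 0`. -/
def inflow (D : Set (Space n)) (s : Sph n) : Set (Space n) :=
  {x ∈ frontier D | ∃ e, IsNormalAt D x e ∧ inner ℝ (s : Space n) e < 0}

/-! ### Fiber spaces -/

/-- `g = s ⬝ ∇v` on `D` in the weak sense. -/
def HasWeakDirDeriv (D : Set (Space n)) (s : Sph n) (v g : Space n → ℝ) : Prop :=
  ∀ φ : Space n → ℝ, ContDiff ℝ ∞ φ → HasCompactSupport φ → tsupport φ ⊆ D →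
    ∫ x, v x * fderiv ℝ φ x s ∂(domMeasure D) = -∫ x, g x * φ x ∂(domMeasure D)

/-- The Hilbert space `L₂(D) × L₂(D)` with norm `(‖v‖² + ‖g‖²)^(1/2)`. -/
abbrev FiberPair (D : Set (Space n)) : Type :=
  WithLp 2 (Lp ℝ 2 (domMeasure D) × Lp ℝ 2 (domMeasure D))

/-- The space `H(s; D)`. An element `v` is represented by the pair `(v, s ⬝ ∇v)` (the weak
derivative is determined by `v`), so that the norm of the pair is `‖v‖_{H(s; D)}`. -/
def fiberH (D : Set (Space n)) (s : Sph n) : Set (FiberPair D) :=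
  {p | HasWeakDirDeriv D s p.fst p.snd}

/-- The elements of `H(s; D)` given by functions in `C¹(closure D)` that vanish on `Γ`. -/
def fiberC1 (D : Set (Space n)) (s : Sph n) (Γ : Set (Space n)) : Set (FiberPair D) :=
  {p ∈ fiberH D s | ∃ u : Space n → ℝ, ContDiffOn ℝ 1 u (closure D) ∧ (∀ x ∈ Γ, u x = 0) ∧
    p.fst =ᵐ[domMeasure D] u}

/-- The space `H_{0,Γ}(s; D)`: the closure of `fiberC1 D s Γ` in `H(s; D)`. -/
def fiberH0 (D : Set (Space n)) (s : Sph n) (Γ : Set (Space n)) : Set (FiberPair D) :=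
  fiberH D s ∩ closure (fiberC1 D s Γ)

/-- `𝒯_s v = s ⬝ ∇v + σ(·, s) v`. -/
def fiberT {D : Set (Space n)} (σ : Space n × Sph n → ℝ) (s : Sph n) (p : FiberPair D) :
    Space n → ℝ :=
  fun x => p.snd x + σ (x, s) * p.fst x

/-- `𝒯*_s v = σ(·, s) v - s ⬝ ∇v`. -/
def fiberTadj {D : Set (Space n)} (σ : Space n × Sph n → ℝ) (s : Sph n) (p : FiberPair D) :
    Space n → ℝ :=
  fun x => σ (x, s) * p.fst x - p.snd x

/-- The bilinear form `a(w, v; s) = ∫_D w (σ(·, s) v - s ⬝ ∇v) dx`. -/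
def fiberForm {D : Set (Space n)} (σ : Space n × Sph n → ℝ) (s : Sph n)
    (w : Lp ℝ 2 (domMeasure D)) (p : FiberPair D) : ℝ :=
  ∫ x, w x * (σ (x, s) * p.fst x - p.snd x) ∂(domMeasure D)

/-- `⟨w, 𝒯*_s v⟩ = a(w, v; s)`, i.e. `fiberTadj` is the adjoint of the operator induced by
the bilinear form. -/
theorem pairing_fiberTadj {D : Set (Space n)} (σ : Space n × Sph n → ℝ) (s : Sph n)
    (w : Lp ℝ 2 (domMeasure D)) (p : FiberPair D) :
    ∫ x, w x * fiberTadj σ s p x ∂(domMeasure D) = fiberForm σ s w p := rfl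

/-! ### Lifted spaces -/

/-- `g = s ⬝ ∇ₓ v` on `D × S` in the weak sense. -/
def HasWeakPhaseDeriv (D : Set (Space n)) (v g : Space n × Sph n → ℝ) : Prop :=
  ∀ φ : Space n × Sph n → ℝ,
    ContMDiff ((𝓘(ℝ, Space n)).prod (𝓡 n)) 𝓘(ℝ, ℝ) ∞ φ → HasCompactSupport φ →
    tsupport φ ⊆ D ×ˢ univ →
    ∫ z, v z * fderiv ℝ (fun x => φ (x, z.2)) z.1 z.2 ∂(phaseMeasure D)
      = -∫ z, g z * φ z ∂(phaseMeasure D)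

/-- The Hilbert space `L₂(D × S) × L₂(D × S)` with norm `(‖v‖² + ‖g‖²)^(1/2)`. -/
abbrev PhasePair (D : Set (Space n)) : Type :=
  WithLp 2 (Lp ℝ 2 (phaseMeasure D) × Lp ℝ 2 (phaseMeasure D))

/-- The space `H(D × S)`. An element `v` is represented by the pair `(v, s ⬝ ∇v)`, so that the
norm of the pair is `‖v‖_{H(D × S)}`. -/
def phaseH (D : Set (Space n)) : Set (PhasePair D) :=
  {p | HasWeakPhaseDeriv D p.fst p.snd}

/-- The elements of `H(D × S)` given by functions in `C¹(closure (D × S))` that vanish at all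
`(x, s)` with `x ∈ Γ s`. -/
def phaseC1 (D : Set (Space n)) (Γ : Sph n → Set (Space n)) : Set (PhasePair D) :=
  {p ∈ phaseH D | ∃ u : Space n × Sph n → ℝ,
    ContMDiffOn ((𝓘(ℝ, Space n)).prod (𝓡 n)) 𝓘(ℝ, ℝ) 1 u (closure D ×ˢ univ) ∧
    (∀ s, ∀ x ∈ Γ s, u (x, s) = 0) ∧ p.fst =ᵐ[phaseMeasure D] u}

/-- The space `H_{0,Γ}(D × S)`: the closure of `phaseC1 D Γ` in `H(D × S)`. -/
def phaseH0 (D : Set (Space n)) (Γ : Sph n → Set (Space n)) : Set (PhasePair D) :=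
  phaseH D ∩ closure (phaseC1 D Γ)

/-- The lifted operator `(𝒯 v)(x, s) = s ⬝ ∇v(x, s) + σ(x, s) v(x, s)`. -/
def phaseT {D : Set (Space n)} (σ : Space n × Sph n → ℝ) (p : PhasePair D) :
    Space n × Sph n → ℝ :=
  fun z => p.snd z + σ z * p.fst z

/-- The lifted adjoint `(𝒯* v)(x, s) = σ(x, s) v(x, s) - s ⬝ ∇v(x, s)`. -/
def phaseTadj {D : Set (Space n)} (σ : Space n × Sph n → ℝ) (p : PhasePair D) :
    Space n × Sph n → ℝ :=
  fun z => σ z * p.fst z - p.snd z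

/-- The section `σ(·, s)` is measurable on `D`, with `m ≤ σ(·, s) ≤ M` almost everywhere on `D`. -/
def GoodSection (D : Set (Space n)) (σ : Space n × Sph n → ℝ) (m M : ℝ) (s : Sph n) : Prop :=
  AEMeasurable (fun x => σ (x, s)) (domMeasure D) ∧
    ∀ᵐ x ∂(domMeasure D), m ≤ σ (x, s) ∧ σ (x, s) ≤ M

/-- `c N ≤ ‖f‖_{L₂(μ)} ≤ C N`, read in `[0, ∞]`. -/
def L2Equiv {α : Type*} [MeasurableSpace α] (μ : Measure α) (c C : ℝ) (f : α → ℝ) (N : ℝ) :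
    Prop :=
  ENNReal.ofReal (c * N) ≤ eLpNorm f 2 μ ∧ eLpNorm f 2 μ ≤ ENNReal.ofReal (C * N)

end Transport

end

open MeasureTheory Metric Set
open scoped ENNReal ContDiff Manifold

noncomputable section

namespace Transport

section Lines

/-! ### A one-dimensional Poincaré inequality -/

/-! The upper bounds are the triangle inequality with `|σ| ≤ |M|`. The lower bounds reduce to one
estimate, `‖v‖ ≤ 2 diam(D) ‖𝒯v‖`: given it, the equation itself controls `s ⬝ ∇v = 𝒯v - σ v`. The
estimate is stable under limits in the graph norm, so it is enough to prove it for C¹ functions `u`,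
whose weak derivative is the classical one (`snd_ae_eq_fderiv`, `phase_snd_ae_eq_fderiv`).

Since `σ ≥ 0`, such a `u` satisfies `u (s ⬝ ∇u) ≤ u 𝒯u`. Every nonempty slice of `D` by a line in
direction `s` is an interval of length at most `diam(D)`. If `u` vanishes where the line enters,
`lintegral_Ioo_sq_le` bounds `u` by `𝒯u` on that line, and Fubini over parallel lines
(`lintegral_le_of_forall_line`) gives the estimate on `D`.

The delicate point is that `u` vanishes only at inflow points where the normal is unique, while a
line may enter through a corner. The entry time is convex in the base point, hence differentiable
almost everywhere, and where it is differentiable its gradient forces every outward normal at the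
entry point to be the same (`entry_mem_inflow`). So almost every line that meets `D` enters through
the inflow boundary.

The adjoint follows by replacing `s` with `-s`, and the lifted statements by integrating over `s`,
as the constant does not depend on the direction. -/

/-- If `w` vanishes at the left end point and `w w' ≤ w f` a.e., then
`‖w‖ ≤ 2 (b - a) ‖f‖` in `L₂(a, b)`. -/
theorem lintegral_Ioo_sq_le {a b L : ℝ} (hab : a < b) (hL : b - a ≤ L) {w w' f : ℝ → ℝ}
    (hc : ContinuousOn w (Icc a b)) (ha : w a = 0)
    (hd : ∀ t ∈ Ioo a b, HasDerivAt w (w' t) t)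
    (hf : AEMeasurable f (volume.restrict (Ioo a b)))
    (h : ∀ᵐ t ∂(volume.restrict (Ioo a b)), w t * w' t ≤ w t * f t) :
    ∫⁻ t in Ioo a b, ‖w t‖ₑ ^ 2 ≤ ENNReal.ofReal (4 * L ^ 2) * ∫⁻ t in Ioo a b, ‖f t‖ₑ ^ 2 := by
  have hL0 : 0 < L := by linarith
  have hpos : 0 < 4 * L ^ 2 := by positivity
  by_cases hfin : ∫⁻ t in Ioo a b, ‖f t‖ₑ ^ 2 = ⊤
  · rw [hfin, ENNReal.mul_top (ENNReal.ofReal_pos.2 hpos).ne']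
    exact le_top
  have e1 : ∀ g : ℝ → ℝ, (fun t => ‖g t‖ₑ ^ 2) = fun t => ENNReal.ofReal (g t ^ 2) := fun g => by
    funext t
    rw [Real.enorm_eq_ofReal_abs, ← ENNReal.ofReal_pow (abs_nonneg _), sq_abs]
  simp only [e1] at hfin ⊢
  have hfi : IntegrableOn (fun t => f t ^ 2) (Ioo a b) := by
    refine ⟨(hf.pow_const 2).aestronglyMeasurable, ?_⟩
    rw [hasFiniteIntegral_iff_ofReal (Filter.Eventually.of_forall fun t => sq_nonneg _)]
    exact lt_top_iff_ne_top.2 hfin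
  have hwi : IntegrableOn (fun t => w t ^ 2) (Ioo a b) :=
    ((hc.pow 2).integrableOn_compact isCompact_Icc).mono_set Ioo_subset_Icc_self
  rw [← ofReal_integral_eq_lintegral_ofReal hwi (Filter.Eventually.of_forall fun t => sq_nonneg _),
    ← ofReal_integral_eq_lintegral_ofReal hfi (Filter.Eventually.of_forall fun t => sq_nonneg _),
    ← ENNReal.ofReal_mul hpos.le]
  apply ENNReal.ofReal_le_ofReal
  -- The weight `b - t` kills the boundary term at `b`, and `w a = 0` kills the one at `a`;
  -- differentiating the weight produces the `-w ^ 2` to be estimated.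
  let g : ℝ → ℝ := fun t => w t ^ 2 * (b - t)
  let g' : ℝ → ℝ := fun t => 2 * w t * w' t * (b - t) - w t ^ 2
  let φ : ℝ → ℝ := fun t => 2 * L ^ 2 * f t ^ 2 - 1 / 2 * w t ^ 2
  have hφi : IntegrableOn φ (Ioo a b) := (hfi.const_mul _).sub (hwi.const_mul _)
  have hle : ∀ᵐ t ∂(volume.restrict (Ioo a b)), g' t ≤ φ t := by
    filter_upwards [h, ae_restrict_mem measurableSet_Ioo] with t ht htm
    have hbt : 0 ≤ b - t := by linarith [htm.2]
    have hbt' : b - t ≤ L := by linarith [htm.1]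
    have h1 : w t * w' t * (b - t) ≤ w t * f t * (b - t) := mul_le_mul_of_nonneg_right ht hbt
    have h2 : (b - t) ^ 2 * f t ^ 2 ≤ L ^ 2 * f t ^ 2 :=
      mul_le_mul_of_nonneg_right (pow_le_pow_left₀ hbt hbt' 2) (sq_nonneg _)
    simp only [g', φ]
    -- Young's inequality `2wf(b - t) ≤ w² / 2 + 2f²(b - t)²`, which leaves half of `w²` on the good
    -- side.
    nlinarith [sq_nonneg (w t - 2 * f t * (b - t))]
  -- The comparison theorem for derivatives wants its bound at every point, but `hle` holds only
  -- almost everywhere. The maximum is a pointwise bound with the same integral as `φ`, and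
  -- integrability of `w'` is never needed.
  have hmax : (fun t => max (g' t) (φ t)) =ᵐ[volume.restrict (Ioo a b)] φ := by
    filter_upwards [hle] with t ht using max_eq_right ht
  have hmi : IntegrableOn (fun t => max (g' t) (φ t)) (Ioo a b) := hφi.congr_fun_ae hmax.symm
  have key := intervalIntegral.sub_le_integral_of_hasDeriv_right_of_le (g := g) (g' := g')
    (φ := fun t => max (g' t) (φ t)) hab.le
    ((hc.pow 2).mul (by fun_prop))
    (fun t ht => by
      have := ((hd t ht).pow 2).mul ((hasDerivAt_id t).const_sub b)
      refine (this.congr_deriv ?_).hasDerivWithinAt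
      simp only [g', id, Pi.pow_apply]
      push_cast
      ring)
    (by rwa [integrableOn_Icc_iff_integrableOn_Ioo])
    (fun t _ => le_max_left _ _)
  rw [intervalIntegral.integral_of_le hab.le, integral_Ioc_eq_integral_Ioo, integral_congr_ae hmax,
    integral_sub (hfi.const_mul _) (hwi.const_mul _), integral_const_mul, integral_const_mul] at key
  simp only [g, ha, sub_self, mul_zero, zero_pow two_ne_zero, zero_mul] at key
  linarith

/-! ### Lines through a bounded convex open set -/

variable {E : Type*} [NormedAddCommGroup E] [InnerProductSpace ℝ E]

/-- The parameter set of the intersection of `D` with the line through `x` in direction `s`. -/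
def lineSlice (D : Set E) (s x : E) : Set ℝ := {t | x + t • s ∈ D}

/-- The parameter at which the line through `x` in direction `s` enters `D`. -/
def entryTime (D : Set E) (s x : E) : ℝ := sInf (lineSlice D s x)

variable {D : Set E} {s : E}

theorem isOpen_lineSlice (hD : IsOpen D) (x : E) : IsOpen (lineSlice D s x) :=
  hD.preimage (f := fun t : ℝ => x + t • s) (by fun_prop)

theorem convex_lineSlice (hD : Convex ℝ D) (x : E) : Convex ℝ (lineSlice D s x) := by
  intro t ht r hr a b ha hb hab
  have := hD ht hr ha hb hab
  change x + (a • t + b • r) • s ∈ D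
  convert this using 1
  obtain rfl : b = 1 - a := by linarith
  simp only [smul_eq_mul]
  module

theorem dist_lineSlice (hs : ‖s‖ = 1) (x : E) (t r : ℝ) :
    dist (x + t • s) (x + r • s) = dist t r := by
  rw [dist_add_left, dist_eq_norm, ← sub_smul, norm_smul, hs, mul_one, dist_eq_norm]

theorem isBounded_lineSlice (hb : Bornology.IsBounded D) (hs : ‖s‖ = 1) (x : E) :
    Bornology.IsBounded (lineSlice D s x) := by
  obtain ⟨C, hC⟩ := Metric.isBounded_iff.1 hb
  refine Metric.isBounded_iff.2 ⟨C, fun t ht r hr => ?_⟩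
  rw [← dist_lineSlice hs x]
  exact hC ht hr

theorem entryTime_lt {x : E} (hD : IsOpen D) (hb : Bornology.IsBounded D) (hs : ‖s‖ = 1)
    {t : ℝ} (ht : t ∈ lineSlice D s x) : entryTime D s x < t := by
  obtain ⟨r, hr, hrs⟩ := exists_Ioc_subset_of_mem_nhds ((isOpen_lineSlice hD x).mem_nhds ht)
    (exists_lt t)
  have : (r + t) / 2 ∈ lineSlice D s x := hrs ⟨by linarith, by linarith⟩
  have := csInf_le (isBounded_lineSlice hb hs x).bddBelow this
  rw [entryTime]
  linarith

theorem lineSlice_eq_Ioo {x : E} (hD : IsOpen D) (hc : Convex ℝ D) (hb : Bornology.IsBounded D)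
    (hs : ‖s‖ = 1) (hne : (lineSlice D s x).Nonempty) :
    lineSlice D s x = Ioo (entryTime D s x) (sSup (lineSlice D s x)) := by
  have hbd := isBounded_lineSlice hb hs x
  refine Subset.antisymm (fun t ht => ⟨entryTime_lt hD hb hs ht, ?_⟩)
    (IsConnected.Ioo_csInf_csSup_subset ⟨hne, (convex_lineSlice hc x).isPreconnected⟩
      hbd.bddBelow hbd.bddAbove)
  obtain ⟨r, hr, hrs⟩ := exists_Ico_subset_of_mem_nhds ((isOpen_lineSlice hD x).mem_nhds ht)
    (exists_gt t)
  have : (r + t) / 2 ∈ lineSlice D s x := hrs ⟨by linarith, by linarith⟩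
  have := le_csSup hbd.bddAbove this
  linarith

theorem mem_closure_of_mem_closure_lineSlice {x : E} {t : ℝ} (ht : t ∈ closure (lineSlice D s x)) :
    x + t • s ∈ closure D :=
  map_mem_closure (f := fun t : ℝ => x + t • s) (by fun_prop) ht fun _ h => h

theorem entry_mem_frontier {x : E} (hD : IsOpen D) (hb : Bornology.IsBounded D) (hs : ‖s‖ = 1)
    (hne : (lineSlice D s x).Nonempty) : x + entryTime D s x • s ∈ frontier D := by
  rw [hD.frontier_eq]
  exact ⟨mem_closure_of_mem_closure_lineSlice
    (csInf_mem_closure hne (isBounded_lineSlice hb hs x).bddBelow),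
    fun h => (entryTime_lt hD hb hs (t := entryTime D s x) h).false⟩

/-- Moving the base point along the line only shifts the parameter, so all points of a line share
one entry point. -/
theorem entryTime_add {x : E} (hb : Bornology.IsBounded D) (hs : ‖s‖ = 1)
    (hne : (lineSlice D s x).Nonempty) (r : ℝ) :
    entryTime D s (x + r • s) = entryTime D s x - r := by
  have hsub : lineSlice D s (x + r • s) = (fun t => t - r) '' lineSlice D s x := by
    ext t
    simp only [lineSlice, mem_ofPred_eq, mem_image]
    constructor
    · intro h
      refine ⟨t + r, ?_, by ring⟩
      convert h using 1
      module
    · rintro ⟨t, h, rfl⟩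
      convert h using 1
      module
  rw [entryTime, hsub]
  exact ((OrderIso.subRight r).map_csInf' hne (isBounded_lineSlice hb hs x).bddBelow).symm

/-- Partial minimization: the entry time is the infimum over `t` of the convex set of pairs `(x, t)`
with `x + t • s ∈ D`. Near-minimizers replace minimizers, since `D` is open and the infimum is not
attained. -/
theorem convexOn_entryTime (hc : Convex ℝ D) (hb : Bornology.IsBounded D) (hs : ‖s‖ = 1) :
    ConvexOn ℝ D (entryTime D s) := by
  refine ⟨hc, fun x hx y hy a b ha hb' hab => le_of_forall_pos_le_add fun ε hε => ?_⟩
  have h0 : ∀ z ∈ D, (lineSlice D s z).Nonempty := fun z hz => ⟨0, by simpa [lineSlice] using hz⟩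
  obtain ⟨t, ht, htε⟩ := exists_lt_of_csInf_lt (h0 x hx)
    (lt_add_of_pos_right (entryTime D s x) hε)
  obtain ⟨r, hr, hrε⟩ := exists_lt_of_csInf_lt (h0 y hy)
    (lt_add_of_pos_right (entryTime D s y) hε)
  have hmem : a * t + b * r ∈ lineSlice D s (a • x + b • y) := by
    have := hc ht hr ha hb' hab
    change a • x + b • y + (a * t + b * r) • s ∈ D
    convert this using 1
    module
  have := csInf_le (isBounded_lineSlice hb hs _).bddBelow hmem
  simp only [smul_eq_mul]
  calc entryTime D s (a • x + b • y) ≤ a * t + b * r := this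
    _ ≤ a * (entryTime D s x + ε) + b * (entryTime D s y + ε) := by gcongr
    _ = _ := by linear_combination ε * hab

/-- A convex function on an open set is locally Lipschitz, so Rademacher's theorem applies near each
point, and a locally null set is null. -/
theorem ae_differentiableAt_entryTime [FiniteDimensional ℝ E] [MeasurableSpace E] [BorelSpace E]
    (μ : Measure E) [μ.IsAddHaarMeasure] (hD : IsOpen D) (hc : Convex ℝ D)
    (hb : Bornology.IsBounded D) (hs : ‖s‖ = 1) :
    ∀ᵐ x ∂μ, x ∈ D → DifferentiableAt ℝ (entryTime D s) x := by
  have hlip := (convexOn_entryTime hc hb hs).locallyLipschitzOn hD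
  refine measure_null_of_locally_null _ fun x hx => ?_
  have hxD : x ∈ D := by
    by_contra h
    exact hx fun h' => absurd h' h
  obtain ⟨K, t, ht, hK⟩ := hlip hxD
  rw [hD.nhdsWithin_eq hxD] at ht
  refine ⟨{x | x ∈ D → DifferentiableAt ℝ (entryTime D s) x}ᶜ ∩ interior t,
    inter_mem_nhdsWithin _ (interior_mem_nhds.2 ht), ?_⟩
  · refine measure_mono_null ?_ (hK.ae_differentiableWithinAt_of_mem (μ := μ))
    rintro y ⟨hy, hyt⟩ h
    exact hy fun _ => (h (interior_subset hyt)).differentiableAt (mem_interior_iff_mem_nhds.1 hyt)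

/-- At a differentiability point of the entry time, an outward normal at the entry point is
determined by the gradient. -/
theorem add_inner_smul_fderiv_eq_zero {x e : E} (hD : IsOpen D) (hb : Bornology.IsBounded D)
    (hs : ‖s‖ = 1) (hx : x ∈ D) (hdiff : DifferentiableAt ℝ (entryTime D s) x)
    (he : ∀ y ∈ D, inner ℝ e (y - (x + entryTime D s x • s)) ≤ 0) (v : E) :
    inner ℝ e v + inner ℝ e s * fderiv ℝ (entryTime D s) x v = 0 := by
  have h0 : ∀ z ∈ D, (lineSlice D s z).Nonempty := fun z hz => ⟨0, by simpa [lineSlice] using hz⟩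
  have hcl : ∀ y ∈ closure D, inner ℝ e (y - (x + entryTime D s x • s)) ≤ 0 := by
    intro y hy
    have hcl : IsClosed {y | inner ℝ e (y - (x + entryTime D s x • s)) ≤ 0} :=
      isClosed_le (by fun_prop) continuous_const
    exact closure_minimal he hcl hy
  -- Up to a constant this function is `inner e` at the entry point of the line through `y`. Entry
  -- points lie in the closure of `D`, hence in the supporting half space, and equality holds at `y
  -- = x`.
  have hmax : IsLocalMax (fun y => inner ℝ e y + inner ℝ e s * entryTime D s y) x := by
    filter_upwards [hD.mem_nhds hx] with y hy
    have := hcl _ (frontier_subset_closure (entry_mem_frontier hD hb hs (h0 y hy)))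
    simp only [inner_sub_right, inner_add_right, inner_smul_right] at this
    linarith
  have hd : HasFDerivAt (fun y => inner ℝ e y + inner ℝ e s * entryTime D s y)
      (innerSL ℝ e + inner ℝ e s • fderiv ℝ (entryTime D s) x) x :=
    (innerSL ℝ e).hasFDerivAt.add (hdiff.hasFDerivAt.const_mul _)
  have := hmax.hasFDerivAt_eq_zero hd
  simpa using congrArg (fun T => T v) this

end Lines

/-! ### Normals at entry points -/

section Domain

variable {n : ℕ}

theorem exists_isOuterNormal {D : Set (Space n)} (hD : IsOpen D) (hc : Convex ℝ D)
    (hne : D.Nonempty) {z : Space n} (hz : z ∉ D) : ∃ e, IsOuterNormal D z e := by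
  obtain ⟨f, hf⟩ := geometric_hahn_banach_open_point hc hD hz
  obtain ⟨x, hx⟩ := hne
  set e := (InnerProductSpace.toDual ℝ (Space n)).symm f with he
  have hin : ∀ y, inner ℝ e y = f y := fun y => InnerProductSpace.toDual_symm_apply
  have he0 : e ≠ 0 := by
    intro h0
    have h1 := hf x hx
    rw [← hin, ← hin, h0, inner_zero_left, inner_zero_left] at h1
    exact h1.false
  refine ⟨‖e‖⁻¹ • e, ?_, fun y hy => ?_⟩
  · rw [norm_smul, norm_inv, norm_norm, inv_mul_cancel₀ (norm_ne_zero_iff.2 he0)]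
  · rw [real_inner_smul_left, inner_sub_right, hin, hin]
    exact mul_nonpos_of_nonneg_of_nonpos (by positivity) (by linarith [hf y hy])

/-- With `τ` the entry time, any outward normal satisfies `e = -(e ⬝ s) ∇τ(x)`. Hence `e ⬝ s ≠ 0`,
and `x ∈ D` behind a negative entry time gives `e ⬝ s < 0`. All normals are thus positive multiples
of one vector, and unit length makes them equal. -/
theorem entry_mem_inflow {D : Set (Space n)} (hD : IsOpen D) (hc : Convex ℝ D)
    (hb : Bornology.IsBounded D) (s : Sph n) {x : Space n} (hx : x ∈ D)
    (hdiff : DifferentiableAt ℝ (entryTime D (s : Space n)) x) :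
    x + entryTime D (s : Space n) x • (s : Space n) ∈ inflow D s := by
  have hs : ‖(s : Space n)‖ = 1 := norm_eq_of_mem_sphere s
  have h0 : (0 : ℝ) ∈ lineSlice D (s : Space n) x := by simpa [lineSlice] using hx
  have hτ := entryTime_lt hD hb hs h0
  have hfr := entry_mem_frontier hD hb hs ⟨0, h0⟩
  set τ := entryTime D (s : Space n) x
  set z := x + τ • (s : Space n)
  have hz : z ∉ D := by
    rw [hD.frontier_eq] at hfr
    exact hfr.2
  have hgrad : ∀ e, IsOuterNormal D z e → ∀ v,
      inner ℝ e v + inner ℝ e (s : Space n) * fderiv ℝ (entryTime D (s : Space n)) x v = 0 :=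
    fun e he => add_inner_smul_fderiv_eq_zero hD hb hs hx hdiff he.2
  have hneg : ∀ e, IsOuterNormal D z e → inner ℝ e (s : Space n) < 0 := by
    intro e he
    refine lt_of_le_of_ne ?_ fun h => ?_
    · have := he.2 x hx
      simp only [z, sub_add_cancel_left, inner_neg_right, real_inner_smul_right] at this
      by_contra! hpos
      nlinarith [mul_pos (neg_pos.2 hτ) hpos]
    · have := hgrad e he e
      rw [h, zero_mul, add_zero, inner_self_eq_zero] at this
      have h1 := he.1
      rw [this, norm_zero] at h1
      exact zero_ne_one h1
  obtain ⟨e, he⟩ := exists_isOuterNormal hD hc ⟨x, hx⟩ hz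
  refine ⟨hfr, e, fun e' => ⟨fun he' => ?_, fun h => h ▸ he⟩, ?_⟩
  · have hk := hneg e he
    have hk' := hneg e' he'
    -- Eliminating the gradient from the two relations shows that `e` and `e'` are parallel.
    have h1 : inner ℝ e (s : Space n) • e' = inner ℝ e' (s : Space n) • e := by
      refine ext_inner_right ℝ fun v => ?_
      rw [real_inner_smul_left, real_inner_smul_left]
      linear_combination inner ℝ e (s : Space n) * hgrad e' he' v
        - inner ℝ e' (s : Space n) * hgrad e he v
    have h2 : inner ℝ e (s : Space n) = inner ℝ e' (s : Space n) := by
      have := congrArg norm h1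
      rw [norm_smul, norm_smul, he.1, he'.1, mul_one, mul_one, Real.norm_of_nonpos hk.le,
        Real.norm_of_nonpos hk'.le] at this
      linarith
    rw [← h2] at h1
    exact smul_right_injective _ hk.ne h1
  · rw [real_inner_comm]
    exact hneg e he

theorem inflow_neg (D : Set (Space n)) (s : Sph n) : inflow D (-s) = outflow D s := by
  simp [inflow, outflow, inner_neg_left]

/-! ### Integration along parallel lines -/

/-- Coordinates in which lines in direction `s` are the vertical ones. -/
theorem exists_lineCoordinates {E : Type*} [NormedAddCommGroup E] [InnerProductSpace ℝ E]
    [FiniteDimensional ℝ E] {s : E} (hs : s ≠ 0) :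
    ∃ (F : Submodule ℝ E) (Φ : (F × ℝ) ≃L[ℝ] E), ∀ y t, Φ (y, t) = y + t • s := by
  refine ⟨(ℝ ∙ s)ᗮ, ((LinearEquiv.prodCongr (LinearEquiv.refl ℝ _)
    (LinearEquiv.toSpanNonzeroSingleton ℝ E s hs)).trans (Submodule.prodEquivOfIsCompl (ℝ ∙ s)ᗮ
      (ℝ ∙ s) ((ℝ ∙ s).isCompl_orthogonal.symm))).toContinuousLinearEquiv,
    fun y t => ?_⟩
  simp [LinearEquiv.toSpanNonzeroSingleton_apply]

/-- An inequality between integrals over almost all lines in direction `s` integrates to an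
inequality over the whole space. -/
theorem lintegral_le_of_forall_line {E : Type*} [NormedAddCommGroup E] [InnerProductSpace ℝ E]
    [FiniteDimensional ℝ E] [MeasurableSpace E] [BorelSpace E] (μ : Measure E)
    [μ.IsAddHaarMeasure] {s : E} (hs : s ≠ 0) {A B : E → ℝ≥0∞} (K : ℝ≥0∞)
    (hA : AEMeasurable A μ) (hB : AEMeasurable B μ) {f : E → ℝ} (hf : AEMeasurable f μ)
    {P : E → Prop} (hP : ∀ᵐ x ∂μ, P x)
    (h : ∀ y : E, (∀ᵐ t : ℝ, P (y + t • s)) → AEMeasurable (fun t : ℝ => f (y + t • s)) →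
      ∫⁻ t : ℝ, A (y + t • s) ≤ K * ∫⁻ t : ℝ, B (y + t • s)) :
    ∫⁻ x, A x ∂μ ≤ K * ∫⁻ x, B x ∂μ := by
  obtain ⟨F, Φ, hΦ⟩ := exists_lineCoordinates hs
  let ν : Measure (F × ℝ) := (Measure.addHaar : Measure F).prod volume
  have hΦm : Measurable Φ := Φ.continuous.measurable
  have hemb : MeasurableEmbedding Φ := Φ.toHomeomorph.measurableEmbedding
  have hHaar : (ν.map Φ).IsAddHaarMeasure := Φ.isAddHaarMeasure_map ν
  -- Uniqueness of Haar measure is used in both directions: this one transfers null sets and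
  -- measurability to the coordinates, the next one gives the Fubini formula for `μ`.
  obtain ⟨k', hμ⟩ : ∃ k : NNReal, ν.map Φ = k • μ := ⟨_, Measure.isAddLeftInvariant_eq_smul _ _⟩
  obtain ⟨k, hμ'⟩ : ∃ k : NNReal, μ = k • ν.map Φ := ⟨_, Measure.isAddLeftInvariant_eq_smul _ _⟩
  have hq : Measure.QuasiMeasurePreserving Φ ν μ := by
    refine ⟨hΦm, ?_⟩
    rw [hμ]
    exact Measure.smul_absolutelyContinuous
  have hint : ∀ G : E → ℝ≥0∞, AEMeasurable G μ → ∫⁻ x, G x ∂μ =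
      k * ∫⁻ y, ∫⁻ t : ℝ, G (y + t • s)
        ∂volume ∂(Measure.addHaar : Measure F) := by
    intro G hG
    conv_lhs => rw [hμ', lintegral_smul_measure, hemb.lintegral_map]
    rw [lintegral_prod]
    · simp only [hΦ]
      rfl
    · exact hG.comp_quasiMeasurePreserving hq
  rw [hint A hA, hint B hB, mul_left_comm]
  gcongr
  calc _ ≤ ∫⁻ y, K * ∫⁻ t : ℝ, B (y + t • s) ∂volume ∂(Measure.addHaar : Measure F) := by
        refine lintegral_mono_ae ?_
        have h1 := Measure.ae_ae_of_ae_prod (hq.ae hP)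
        have h2 := (hf.comp_quasiMeasurePreserving hq).aestronglyMeasurable.prodMk_left
        filter_upwards [h1, h2] with y hy1 hy2
        refine h y ?_ ?_
        · simpa only [hΦ] using hy1
        · simpa only [hΦ, Function.comp] using hy2.aemeasurable
    _ = _ := by
        refine lintegral_const_mul'' K ?_
        have := (hB.comp_quasiMeasurePreserving hq).lintegral_prod_right'
        simpa only [hΦ, Function.comp] using this

/-- Poincaré inequality for functions vanishing on the inflow boundary. -/
theorem lintegral_sq_le_of_inflow {D : Set (Space n)} (hD : IsOpen D) (hc : Convex ℝ D)
    (hb : Bornology.IsBounded D) (s : Sph n) {u f : Space n → ℝ}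
    (hu : ContDiffOn ℝ 1 u (closure D)) (hu0 : ∀ x ∈ inflow D s, u x = 0)
    (hf : AEMeasurable f (domMeasure D))
    (h : ∀ᵐ x ∂(domMeasure D), u x * fderiv ℝ u x s ≤ u x * f x) :
    ∫⁻ x, ‖u x‖ₑ ^ 2 ∂(domMeasure D) ≤
      ENNReal.ofReal (4 * diam D ^ 2) * ∫⁻ x, ‖f x‖ₑ ^ 2 ∂(domMeasure D) := by
  have hs : ‖(s : Space n)‖ = 1 := norm_eq_of_mem_sphere s
  have hs0 : (s : Space n) ≠ 0 := fun h => by simp [h] at hs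
  have hum : AEMeasurable u (domMeasure D) :=
    (hu.continuousOn.mono subset_closure).aemeasurable hD.measurableSet
  have hdiff := ae_differentiableAt_entryTime (volume : Measure (Space n)) hD hc hb hs
  rw [ae_restrict_iff' hD.measurableSet] at h
  rw [← lintegral_indicator hD.measurableSet, ← lintegral_indicator hD.measurableSet]
  refine lintegral_le_of_forall_line volume hs0 _
    ((aemeasurable_indicator_iff hD.measurableSet).2 (hum.enorm.pow_const 2))
    ((aemeasurable_indicator_iff hD.measurableSet).2 (hf.enorm.pow_const 2))
    ((aemeasurable_indicator_iff hD.measurableSet).2 hf) (hdiff.and h) fun y hy hfy => ?_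
  have hind : ∀ g : Space n → ℝ, ∫⁻ t : ℝ, D.indicator (fun x => ‖g x‖ₑ ^ 2) (y + t • (s : Space n))
      = ∫⁻ t in lineSlice D (s : Space n) y, ‖g (y + t • (s : Space n))‖ₑ ^ 2 := fun g => by
    rw [← lintegral_indicator (isOpen_lineSlice hD y).measurableSet]
    rfl
  rw [hind, hind]
  rcases (lineSlice D (s : Space n) y).eq_empty_or_nonempty with he | hne
  · simp [he]
  have hI := lineSlice_eq_Ioo hD hc hb hs hne
  have hIm := (isOpen_lineSlice (s := (s : Space n)) hD y).measurableSet
  -- A nonempty slice is open and so has positive length; a property valid almost everywhere on the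
  -- line therefore holds at some `t₀` in the slice. One such point suffices, because its entry
  -- point is that of the whole line.
  have hnb : (ae (volume.restrict (lineSlice D (s : Space n) y))).NeBot := by
    rw [ae_neBot, Ne, Measure.restrict_eq_zero]
    exact ((isOpen_lineSlice hD y).measure_pos volume hne).ne'
  obtain ⟨t₀, ht₀, ht₀m⟩ := ((ae_restrict_of_ae hy).and (ae_restrict_mem hIm)).exists
  have hentry := entry_mem_inflow hD hc hb s ht₀m (ht₀.1 ht₀m)
  rw [entryTime_add hb hs hne, add_assoc, ← add_smul, add_sub_cancel] at hentry
  set a := entryTime D (s : Space n) y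
  set b := sSup (lineSlice D (s : Space n) y)
  have hab : a < b := by
    rw [hI] at ht₀m
    exact ht₀m.1.trans ht₀m.2
  have hIcc : ∀ t ∈ Icc a b, y + t • (s : Space n) ∈ closure D := fun t ht =>
    mem_closure_of_mem_closure_lineSlice (by rwa [hI, closure_Ioo hab.ne])
  have hle : b - a ≤ diam D := by
    rw [← Metric.diam_closure]
    have := dist_le_diam_of_mem hb.closure (hIcc b (right_mem_Icc.2 hab.le))
      (hIcc a (left_mem_Icc.2 hab.le))
    rw [dist_lineSlice hs, Real.dist_eq] at this
    exact (le_abs_self _).trans this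
  have hfI : AEMeasurable (fun t : ℝ => f (y + t • (s : Space n)))
      (volume.restrict (lineSlice D (s : Space n) y)) := by
    refine hfy.restrict.congr ?_
    filter_upwards [ae_restrict_mem hIm] with t ht using Set.indicator_of_mem (s := D) ht f
  have hineq : ∀ᵐ t ∂(volume.restrict (lineSlice D (s : Space n) y)),
      u (y + t • (s : Space n)) * fderiv ℝ u (y + t • (s : Space n)) s ≤
        u (y + t • (s : Space n)) * f (y + t • (s : Space n)) := by
    filter_upwards [ae_restrict_mem hIm, ae_restrict_of_ae hy] with t ht hyt using hyt.2 ht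
  rw [hI] at hfI hineq ⊢
  refine lintegral_Ioo_sq_le (w := fun t : ℝ => u (y + t • (s : Space n)))
    (w' := fun t : ℝ => fderiv ℝ u (y + t • (s : Space n)) s) hab hle ?_ (hu0 _ hentry) ?_ hfI hineq
  · exact hu.continuousOn.comp (by fun_prop) hIcc
  · intro t ht
    have htD : y + t • (s : Space n) ∈ D := by
      rw [← hI] at ht
      exact ht
    have hd : DifferentiableAt ℝ u (y + t • (s : Space n)) :=
      ((hu.mono subset_closure).differentiableOn one_ne_zero).differentiableAt (hD.mem_nhds htD)
    have hl : HasDerivAt (fun t : ℝ => y + t • (s : Space n)) s t := by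
      simpa using ((hasDerivAt_id t).smul_const (s : Space n)).const_add y
    exact hd.hasFDerivAt.comp_hasDerivAt t hl

end Domain

section Weak

/-! ### Weak and classical directional derivatives -/

/-- Nothing is known of `a` outside `O`, but there the product vanishes near each point. -/
theorem continuous_mul_of_tsupport_subset {X : Type*} [TopologicalSpace X] {O : Set X}
    (hO : IsOpen O) {a b : X → ℝ} (ha : ContinuousOn a O) (hb : Continuous b)
    (hbO : tsupport b ⊆ O) : Continuous fun x => a x * b x := by
  refine continuous_iff_continuousAt.2 fun x => ?_
  by_cases hx : x ∈ tsupport b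
  · exact (ha.continuousAt (hO.mem_nhds (hbO hx))).mul hb.continuousAt
  · have h0 := notMem_tsupport_iff_eventuallyEq.1 hx
    refine (continuousAt_const (y := (0 : ℝ))).congr ?_
    filter_upwards [h0] with y hy
    simp [hy]

theorem integrable_mul_of_tsupport_subset {X : Type*} [TopologicalSpace X] [MeasurableSpace X]
    [OpensMeasurableSpace X] {μ : Measure X}
    [IsFiniteMeasureOnCompacts μ] {O : Set X} (hO : IsOpen O) {a b : X → ℝ}
    (ha : ContinuousOn a O) (hb : Continuous b) (hbc : HasCompactSupport b)
    (hbO : tsupport b ⊆ O) : Integrable (fun x => a x * b x) μ :=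
  (continuous_mul_of_tsupport_subset hO ha hb hbO).integrable_of_hasCompactSupport hbc.mul_left

/-- Fundamental lemma of the calculus of variations for a locally integrable function and a
function that is continuous on an open set. -/
theorem ae_eq_of_forall_integral_mul_eq {E H M : Type*} [NormedAddCommGroup E] [NormedSpace ℝ E]
    [FiniteDimensional ℝ E] [TopologicalSpace H] (I : ModelWithCorners ℝ E H)
    [TopologicalSpace M] [ChartedSpace H M] [IsManifold I ∞ M] [MeasurableSpace M] [BorelSpace M]
    [T2Space M] [SigmaCompactSpace M] {μ : Measure M}
    [IsLocallyFiniteMeasure μ] {O : Set M} (hO : IsOpen O) {g w : M → ℝ}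
    (hg : LocallyIntegrable g μ) (hw : ContinuousOn w O)
    (h : ∀ φ : M → ℝ, ContMDiff I 𝓘(ℝ, ℝ) ∞ φ → HasCompactSupport φ → tsupport φ ⊆ O →
      ∫ x, g x * φ x ∂μ = ∫ x, w x * φ x ∂μ) :
    ∀ᵐ x ∂μ, x ∈ O → g x = w x := by
  have := hO.ae_eq_zero_of_integral_contMDiff_smul_eq_zero I (f := fun x => g x - w x) (μ := μ)
    ((hg.locallyIntegrableOn O).sub (hw.locallyIntegrableOn hO.measurableSet))
    (fun φ hφ hφc hφO => by
      have h1 : Integrable (fun x => g x * φ x) μ := by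
        simpa only [smul_eq_mul, mul_comm] using
          hg.integrable_smul_left_of_hasCompactSupport hφ.continuous hφc
      have h2 := integrable_mul_of_tsupport_subset (μ := μ) hO hw hφ.continuous hφc hφO
      rw [← sub_eq_zero.2 (h φ hφ hφc hφO), ← integral_sub h1 h2]
      congr 1 with x
      simp only [smul_eq_mul]
      ring)
  filter_upwards [this] with x hx hxO using sub_eq_zero.1 (hx hxO)

variable {n : ℕ}

/-- Integration by parts on an open set against a compactly supported function. -/
theorem integral_mul_fderiv_eq_neg {D : Set (Space n)} (hD : IsOpen D) (s : Space n)
    {u φ : Space n → ℝ} (hu : ContDiffOn ℝ 1 u D) (hφ : ContDiff ℝ ∞ φ)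
    (hφc : HasCompactSupport φ) (hφD : tsupport φ ⊆ D) :
    ∫ x, u x * fderiv ℝ φ x s ∂(domMeasure D) = -∫ x, fderiv ℝ u x s * φ x ∂(domMeasure D) := by
  have hd : Continuous fun x => fderiv ℝ φ x s :=
    (hφ.continuous_fderiv (by simp)).clm_apply continuous_const
  have hdD : tsupport (fun x => fderiv ℝ φ x s) ⊆ D :=
    (tsupport_fderiv_apply_subset ℝ s).trans hφD
  have hdc : HasCompactSupport fun x => fderiv ℝ φ x s := hφc.fderiv_apply (𝕜 := ℝ) s
  have hu' : ContinuousOn (fun x => fderiv ℝ u x s) D :=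
    (hu.continuousOn_fderiv_of_isOpen hD le_rfl).clm_apply continuousOn_const
  have key := integral_mul_fderiv_eq_neg_fderiv_mul_of_integrable (μ := (volume : Measure (Space n)))
    (integrable_mul_of_tsupport_subset hD hu' hφ.continuous hφc hφD)
    (integrable_mul_of_tsupport_subset hD hu.continuousOn hd hdc hdD)
    (integrable_mul_of_tsupport_subset hD hu.continuousOn hφ.continuous hφc hφD)
    (fun x hx => (hu.differentiableOn one_ne_zero).differentiableAt (hD.mem_nhds (hφD hx)))
    (fun x _ => hφ.differentiable (by simp) x)
  rw [setIntegral_eq_integral_of_forall_compl_eq_zero,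
    setIntegral_eq_integral_of_forall_compl_eq_zero, key]
  · intro x hx
    rw [image_eq_zero_of_notMem_tsupport fun h => hx (hφD h), mul_zero]
  · intro x hx
    rw [image_eq_zero_of_notMem_tsupport (f := fun x => fderiv ℝ φ x s) fun h => hx (hdD h),
      mul_zero]

/-- Both candidates for the derivative have the same integral against every test function, one by
definition and the other by classical integration by parts, so the fundamental lemma identifies
them. -/
theorem snd_ae_eq_fderiv {D : Set (Space n)} (hD : IsOpen D) {s : Sph n} {p : FiberPair D}
    (hp : p ∈ fiberH D s) {u : Space n → ℝ} (hu : ContDiffOn ℝ 1 u D)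
    (hpu : p.fst =ᵐ[domMeasure D] u) :
    ∀ᵐ x ∂(domMeasure D), p.snd x = fderiv ℝ u x s := by
  have hu' : ContinuousOn (fun x => fderiv ℝ u x s) D :=
    (hu.continuousOn_fderiv_of_isOpen hD le_rfl).clm_apply continuousOn_const
  have := ae_eq_of_forall_integral_mul_eq 𝓘(ℝ, Space n) (μ := domMeasure D) hD
    ((Lp.memLp p.snd).locallyIntegrable one_le_two) hu' (fun φ hφ hφc hφD => by
      have h1 := hp φ hφ.contDiff hφc hφD
      rw [← neg_inj, ← h1, ← integral_mul_fderiv_eq_neg hD s hu hφ.contDiff hφc hφD]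
      refine integral_congr_ae ?_
      filter_upwards [hpu] with x hx
      rw [hx])
  filter_upwards [this, ae_restrict_mem hD.measurableSet] with x hx hxD using hx hxD

/-! ### Functions on the phase space -/

theorem continuousAt_fderiv_section {w : Space n × Sph n → ℝ} {z₀ : Space n × Sph n}
    (hw : ContMDiffAt ((𝓘(ℝ, Space n)).prod (𝓡 n)) 𝓘(ℝ, ℝ) 1 w z₀) :
    ContinuousAt (fun z => fderiv ℝ (fun x => w (x, z.2)) z.1 z.2) z₀ := by
  have h := ContMDiffAt.mfderiv (N := Space n × Sph n) (J := (𝓘(ℝ, Space n)).prod (𝓡 n))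
    (I := 𝓘(ℝ, Space n)) (I' := 𝓘(ℝ, ℝ)) (m := 0) (n := 1) (x₀ := z₀)
    (fun z x => w (x, z.2)) Prod.fst
    (by
      have h2 : ContMDiffAt (((𝓘(ℝ, Space n)).prod (𝓡 n)).prod 𝓘(ℝ, Space n))
          ((𝓘(ℝ, Space n)).prod (𝓡 n)) 1
          (fun q : (Space n × Sph n) × Space n => (q.2, q.1.2)) (z₀, z₀.1) :=
        contMDiffAt_snd.prodMk (contMDiffAt_snd.comp _ contMDiffAt_fst)
      exact ContMDiffAt.comp (z₀, z₀.1) (g := w) hw h2)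
    contMDiffAt_fst (by norm_num)
  simp only [mfderiv_eq_fderiv] at h
  -- Between vector spaces the tangent coordinates are trivial, so the manifold statement `h` is
  -- plain continuity of the `x`-derivative, including its dependence on `s`.
  have e := inTangentCoordinates_model_space (I := 𝓘(ℝ, Space n)) (I' := 𝓘(ℝ, ℝ))
    (Prod.fst : Space n × Sph n → Space n) (fun z => w (z.1, z.2))
    (fun z => fderiv ℝ (fun x => w (x, z.2)) z.1) z₀
  have hc : ContinuousAt (fun z : Space n × Sph n => fderiv ℝ (fun x => w (x, z.2)) z.1) z₀ := by
    rw [← e]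
    exact h.continuousAt
  have hv : ContinuousAt (fun z : Space n × Sph n => (z.2 : Space n)) z₀ := by fun_prop
  exact ContinuousAt.clm_apply hc hv

theorem contMDiff_section (s : Sph n) :
    ContMDiff 𝓘(ℝ, Space n) ((𝓘(ℝ, Space n)).prod (𝓡 n)) ∞ fun x : Space n => (x, s) :=
  contMDiff_id.prodMk contMDiff_const

theorem contDiffOn_section {A : Set (Space n)}
    {w : Space n × Sph n → ℝ}
    (hw : ContMDiffOn ((𝓘(ℝ, Space n)).prod (𝓡 n)) 𝓘(ℝ, ℝ) 1 w (A ×ˢ univ)) (s : Sph n) :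
    ContDiffOn ℝ 1 (fun x => w (x, s)) A := by
  rw [← contMDiffOn_iff_contDiffOn]
  exact hw.comp ((contMDiff_section s).of_le (by simp)).contMDiffOn fun x hx => ⟨hx, mem_univ _⟩

theorem tsupport_section_subset (w : Space n × Sph n → ℝ) (s : Sph n) :
    tsupport (fun x => w (x, s)) ⊆ (fun x => (x, s)) ⁻¹' tsupport w :=
  closure_minimal (fun _ hx => subset_closure hx)
    ((isClosed_tsupport w).preimage (by fun_prop))

theorem support_fderiv_section_subset (w : Space n × Sph n → ℝ) :
    Function.support (fun z : Space n × Sph n => fderiv ℝ (fun x => w (x, z.2)) z.1 z.2) ⊆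
      tsupport w := by
  intro z hz
  by_contra h
  have h1 : z.1 ∉ tsupport (fun x => w (x, z.2)) := fun h2 => h (tsupport_section_subset w z.2 h2)
  have h2 : z.1 ∉ tsupport (fderiv ℝ fun x => w (x, z.2)) := fun h3 =>
    h1 (tsupport_fderiv_subset ℝ h3)
  refine hz ?_
  simp only [image_eq_zero_of_notMem_tsupport h2, zero_apply]

/-- Only `x` is differentiated, so after Fubini this is the integration by parts on `D` for each
fixed `s`. -/
theorem integral_phase_mul_fderiv_eq_neg {D : Set (Space n)} (hD : IsOpen D)
    {u φ : Space n × Sph n → ℝ}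
    (hu : ContMDiffOn ((𝓘(ℝ, Space n)).prod (𝓡 n)) 𝓘(ℝ, ℝ) 1 u (D ×ˢ univ))
    (hu' : ContinuousOn (fun z => fderiv ℝ (fun x => u (x, z.2)) z.1 z.2) (D ×ˢ univ))
    (hφ : ContMDiff ((𝓘(ℝ, Space n)).prod (𝓡 n)) 𝓘(ℝ, ℝ) ∞ φ)
    (hφc : HasCompactSupport φ) (hφD : tsupport φ ⊆ D ×ˢ univ) :
    ∫ z, u z * fderiv ℝ (fun x => φ (x, z.2)) z.1 z.2 ∂(phaseMeasure D) =
      -∫ z, fderiv ℝ (fun x => u (x, z.2)) z.1 z.2 * φ z ∂(phaseMeasure D) := by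
  have hO : IsOpen (D ×ˢ (univ : Set (Sph n))) := hD.prod isOpen_univ
  have hd : Continuous fun z : Space n × Sph n => fderiv ℝ (fun x => φ (x, z.2)) z.1 z.2 :=
    continuous_iff_continuousAt.2 fun z =>
      continuousAt_fderiv_section ((hφ.of_le (by simp)).contMDiffAt)
  have hsub : tsupport (fun z : Space n × Sph n => fderiv ℝ (fun x => φ (x, z.2)) z.1 z.2) ⊆
      tsupport φ := closure_minimal (support_fderiv_section_subset φ) (isClosed_tsupport φ)
  have hdc : HasCompactSupport fun z : Space n × Sph n =>
      fderiv ℝ (fun x => φ (x, z.2)) z.1 z.2 := hφc.of_isClosed_subset (isClosed_tsupport _) hsub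
  rw [integral_prod_symm _ (integrable_mul_of_tsupport_subset hO hu.continuousOn hd hdc
      (hsub.trans hφD)),
    integral_prod_symm _ (integrable_mul_of_tsupport_subset hO hu' hφ.continuous hφc hφD),
    ← integral_neg]
  congr 1 with s
  have hsec := tsupport_section_subset φ s
  have hφs : ContDiff ℝ ∞ fun x => φ (x, s) := by
    rw [← contMDiff_iff_contDiff]
    exact hφ.comp (contMDiff_section s)
  refine integral_mul_fderiv_eq_neg hD s (contDiffOn_section hu s) hφs ?_
    fun x hx => (hφD (hsec hx)).1
  exact (hφc.isCompact.image continuous_fst).of_isClosed_subset (isClosed_tsupport _)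
    fun x hx => ⟨(x, s), hsec hx, rfl⟩

theorem phase_snd_ae_eq_fderiv {D : Set (Space n)} (hD : IsOpen D) {p : PhasePair D}
    (hp : p ∈ phaseH D) {u : Space n × Sph n → ℝ}
    (hu : ContMDiffOn ((𝓘(ℝ, Space n)).prod (𝓡 n)) 𝓘(ℝ, ℝ) 1 u (D ×ˢ univ))
    (hpu : p.fst =ᵐ[phaseMeasure D] u) :
    ∀ᵐ z ∂(phaseMeasure D), p.snd z = fderiv ℝ (fun x => u (x, z.2)) z.1 z.2 := by
  have hO : IsOpen (D ×ˢ (univ : Set (Sph n))) := hD.prod isOpen_univ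
  have hu' : ContinuousOn (fun z => fderiv ℝ (fun x => u (x, z.2)) z.1 z.2) (D ×ˢ univ) :=
    fun z hz => (continuousAt_fderiv_section
      (hu.contMDiffAt (hO.mem_nhds hz))).continuousWithinAt
  have := ae_eq_of_forall_integral_mul_eq ((𝓘(ℝ, Space n)).prod (𝓡 n)) (μ := phaseMeasure D) hO
    ((Lp.memLp p.snd).locallyIntegrable one_le_two) hu' (fun φ hφ hφc hφD => by
      have h1 := hp φ hφ hφc hφD
      rw [← neg_inj, ← h1, ← integral_phase_mul_fderiv_eq_neg hD hu hu' hφ hφc hφD]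
      refine integral_congr_ae ?_
      filter_upwards [hpu] with x hx
      rw [hx])
  have hmem : ∀ᵐ z ∂(phaseMeasure D), z.1 ∈ D :=
    Measure.quasiMeasurePreserving_fst.ae (ae_restrict_mem hD.measurableSet)
  filter_upwards [this, hmem] with z hz hzD using hz ⟨hzD, mem_univ _⟩

end Weak

section Equiv

/-! ### From inequalities to equivalence of norms -/

section Abstract

variable {α : Type*} [MeasurableSpace α] {μ : Measure α}

theorem eLpNorm_two_sq (f : α → ℝ) : eLpNorm f 2 μ ^ 2 = ∫⁻ x, ‖f x‖ₑ ^ 2 ∂μ := by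
  have := eLpNorm_nnreal_pow_eq_lintegral (f := f) (μ := μ) (p := 2) two_ne_zero
  simpa using this

theorem ae_norm_mul_le {σ : α → ℝ} {M : ℝ} (hM : ∀ᵐ x ∂μ, |σ x| ≤ M) (v : α → ℝ) :
    ∀ᵐ x ∂μ, ‖σ x * v x‖ ≤ M * ‖v x‖ := by
  filter_upwards [hM] with x hx
  rw [norm_mul]
  exact mul_le_mul_of_nonneg_right hx (norm_nonneg _)

theorem memLp_mul {σ : α → ℝ} {M : ℝ} (hσ : AEMeasurable σ μ) (hM : ∀ᵐ x ∂μ, |σ x| ≤ M)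
    (v : Lp ℝ 2 μ) : MemLp (fun x => σ x * v x) 2 μ :=
  (Lp.memLp v).of_le_mul (hσ.aestronglyMeasurable.mul (Lp.aestronglyMeasurable v))
    (ae_norm_mul_le hM v)

/-- Multiplication by a bounded function on `L₂`. -/
def mulL2 {σ : α → ℝ} {M : ℝ} (hσ : AEMeasurable σ μ) (hM : ∀ᵐ x ∂μ, |σ x| ≤ M) :
    Lp ℝ 2 μ →L[ℝ] Lp ℝ 2 μ :=
  LinearMap.mkContinuous
    { toFun := fun v => (memLp_mul hσ hM v).toLp
      map_add' := fun v w => by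
        refine Lp.ext ?_
        filter_upwards [MemLp.coeFn_toLp (memLp_mul hσ hM (v + w)),
          MemLp.coeFn_toLp (memLp_mul hσ hM v), MemLp.coeFn_toLp (memLp_mul hσ hM w),
          Lp.coeFn_add v w, Lp.coeFn_add (memLp_mul hσ hM v).toLp (memLp_mul hσ hM w).toLp]
          with x h1 h2 h3 h4 h5
        rw [h1, h5, Pi.add_apply, h2, h3, h4, Pi.add_apply, mul_add]
      map_smul' := fun c v => by
        refine Lp.ext ?_
        filter_upwards [MemLp.coeFn_toLp (memLp_mul hσ hM (c • v)),
          MemLp.coeFn_toLp (memLp_mul hσ hM v), Lp.coeFn_smul c v,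
          Lp.coeFn_smul c (memLp_mul hσ hM v).toLp] with x h1 h2 h3 h4
        rw [h1, RingHom.id_apply, h4, Pi.smul_apply, h2, h3, Pi.smul_apply, smul_eq_mul,
          smul_eq_mul, mul_left_comm] }
    M fun v => by
      refine Lp.norm_le_mul_norm_of_ae_le_mul ?_
      filter_upwards [MemLp.coeFn_toLp (memLp_mul hσ hM v), ae_norm_mul_le hM v] with x h1 h2
      simpa only [LinearMap.coe_mk, AddHom.coe_mk, h1] using h2

theorem coeFn_mulL2 {σ : α → ℝ} {M : ℝ} (hσ : AEMeasurable σ μ) (hM : ∀ᵐ x ∂μ, |σ x| ≤ M)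
    (v : Lp ℝ 2 μ) : mulL2 hσ hM v =ᵐ[μ] fun x => σ x * v x :=
  MemLp.coeFn_toLp (memLp_mul hσ hM v)

theorem norm_mulL2_le {σ : α → ℝ} {M : ℝ} (hσ : AEMeasurable σ μ) (hM : ∀ᵐ x ∂μ, |σ x| ≤ M)
    (v : Lp ℝ 2 μ) : ‖mulL2 hσ hM v‖ ≤ M * ‖v‖ := by
  refine Lp.norm_le_mul_norm_of_ae_le_mul ?_
  filter_upwards [coeFn_mulL2 hσ hM v, ae_norm_mul_le hM v] with x h1 h2
  rwa [h1]

/-- The sign `ε = ±1` treats the operator and its adjoint together. The norm of the pair is the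
graph norm, for which the operator is continuous; a Poincaré inequality on `S` therefore extends to
the closure. -/
theorem l2Equiv_of_mem_closure {σ : α → ℝ} {M K ε : ℝ} (hM0 : 0 ≤ M) (hK : 0 ≤ K)
    (hε : |ε| = 1) (hσ : AEMeasurable σ μ) (hM : ∀ᵐ x ∂μ, |σ x| ≤ M)
    {S : Set (WithLp 2 (Lp ℝ 2 μ × Lp ℝ 2 μ))}
    (h : ∀ p ∈ S, ∫⁻ x, ‖p.fst x‖ₑ ^ 2 ∂μ ≤
      ENNReal.ofReal (K ^ 2) * ∫⁻ x, ‖ε * p.snd x + σ x * p.fst x‖ₑ ^ 2 ∂μ)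
    {p : WithLp 2 (Lp ℝ 2 μ × Lp ℝ 2 μ)} (hp : p ∈ closure S) :
    L2Equiv μ (1 + (1 + M) * K)⁻¹ (1 + M) (fun x => ε * p.snd x + σ x * p.fst x) ‖p‖ := by
  let T : WithLp 2 (Lp ℝ 2 μ × Lp ℝ 2 μ) → Lp ℝ 2 μ := fun p => ε • p.snd + mulL2 hσ hM p.fst
  have hT : ∀ p, T p =ᵐ[μ] fun x => ε * p.snd x + σ x * p.fst x := fun p => by
    filter_upwards [Lp.coeFn_add (ε • p.snd) (mulL2 hσ hM p.fst), Lp.coeFn_smul ε p.snd,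
      coeFn_mulL2 hσ hM p.fst] with x h1 h2 h3
    rw [h1, Pi.add_apply, h2, h3, Pi.smul_apply, smul_eq_mul]
  have hTn : ∀ p, eLpNorm (fun x => ε * p.snd x + σ x * p.fst x) 2 μ = ENNReal.ofReal ‖T p‖ :=
    fun p => by rw [← eLpNorm_congr_ae (hT p), ← Lp.enorm_def, ofReal_norm]
  have hTc : Continuous T := by
    have h1 : Continuous fun p : WithLp 2 (Lp ℝ 2 μ × Lp ℝ 2 μ) => p.fst :=
      continuous_fst.comp (WithLp.prod_continuous_ofLp 2 _ _)
    have h2 : Continuous fun p : WithLp 2 (Lp ℝ 2 μ × Lp ℝ 2 μ) => p.snd :=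
      continuous_snd.comp (WithLp.prod_continuous_ofLp 2 _ _)
    exact (h2.const_smul ε).add ((mulL2 hσ hM).continuous.comp h1)
  have hfst : ‖p.fst‖ ≤ K * ‖T p‖ := by
    have hcl : IsClosed {p : WithLp 2 (Lp ℝ 2 μ × Lp ℝ 2 μ) | ‖p.fst‖ ≤ K * ‖T p‖} :=
      isClosed_le (continuous_fst.comp (WithLp.prod_continuous_ofLp 2 _ _)).norm
        (continuous_const.mul hTc.norm)
    refine closure_minimal (fun q hq => ?_) hcl hp
    have h1 := h q hq
    rw [← eLpNorm_two_sq, ← eLpNorm_two_sq, hTn, ← Lp.enorm_def, ← ofReal_norm,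
      ← ENNReal.ofReal_pow (norm_nonneg _), ← ENNReal.ofReal_pow (norm_nonneg _),
      ← ENNReal.ofReal_mul (sq_nonneg K), ENNReal.ofReal_le_ofReal_iff (by positivity),
      ← mul_pow] at h1
    exact le_of_sq_le_sq h1 (by positivity)
  have hsnd : ‖p.snd‖ ≤ ‖T p‖ + M * ‖p.fst‖ := by
    have h1 : ε • p.snd = T p - mulL2 hσ hM p.fst := by simp [T]
    have h2 := norm_sub_le (T p) (mulL2 hσ hM p.fst)
    rw [← h1, norm_smul, Real.norm_eq_abs, hε, one_mul] at h2
    linarith [norm_mulL2_le hσ hM p.fst]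
  have hp_le : ‖p‖ ≤ ‖p.fst‖ + ‖p.snd‖ := by
    refine le_of_sq_le_sq ?_ (by positivity)
    rw [WithLp.prod_norm_sq_eq_of_L2]
    nlinarith [mul_nonneg (norm_nonneg p.fst) (norm_nonneg p.snd)]
  unfold L2Equiv
  rw [hTn]
  refine ⟨ENNReal.ofReal_le_ofReal ?_, ENNReal.ofReal_le_ofReal ?_⟩
  · rw [inv_mul_le_iff₀ (by positivity)]
    -- `‖p‖ ≤ ‖p.fst‖ + ‖p.snd‖ ≤ ‖T p‖ + (1 + M) ‖p.fst‖ ≤ (1 + (1 + M) K) ‖T p‖`.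
    nlinarith [mul_le_mul_of_nonneg_left hfst (by positivity : 0 ≤ 1 + M)]
  · calc ‖T p‖ ≤ ‖p.snd‖ + M * ‖p.fst‖ := by
          refine (norm_add_le _ _).trans (add_le_add ?_ (norm_mulL2_le hσ hM p.fst))
          rw [norm_smul, Real.norm_eq_abs, hε, one_mul]
      _ ≤ ‖p‖ + M * ‖p‖ := by
          gcongr
          · exact WithLp.norm_snd_le (x := p)
          · exact WithLp.norm_fst_le (x := p)
      _ = (1 + M) * ‖p‖ := by ring

theorem lintegral_prod_le_of_ae_section {β : Type*} [MeasurableSpace β] {ν : Measure β}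
    [SFinite μ] [SFinite ν] {A B : α × β → ℝ≥0∞} (K : ℝ≥0∞) (hA : AEMeasurable A (μ.prod ν))
    (hB : AEMeasurable B (μ.prod ν))
    (h : ∀ᵐ y ∂ν, ∫⁻ x, A (x, y) ∂μ ≤ K * ∫⁻ x, B (x, y) ∂μ) :
    ∫⁻ z, A z ∂μ.prod ν ≤ K * ∫⁻ z, B z ∂μ.prod ν := by
  rw [lintegral_prod_symm _ hA, lintegral_prod_symm _ hB]
  exact (lintegral_mono_ae h).trans_eq
    (lintegral_const_mul'' K hB.prod_swap.lintegral_prod_right')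

/-- Almost every section in the second variable of a property that holds a.e. -/
theorem ae_ae_swap {β : Type*} [MeasurableSpace β] {ν : Measure β} [SFinite μ] [SFinite ν]
    {P : α × β → Prop} (h : ∀ᵐ z ∂μ.prod ν, P z) : ∀ᵐ y ∂ν, ∀ᵐ x ∂μ, P (x, y) :=
  Measure.ae_ae_of_ae_prod (Measure.measurePreserving_swap.quasiMeasurePreserving.ae h)

theorem ae_aemeasurable_section {β : Type*} [MeasurableSpace β] {ν : Measure β} [SFinite μ]
    [SFinite ν] {f : α × β → ℝ} (hf : AEMeasurable f (μ.prod ν)) :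
    ∀ᵐ y ∂ν, AEMeasurable (fun x => f (x, y)) μ := by
  filter_upwards [hf.prod_swap.aestronglyMeasurable.prodMk_left] with y hy using hy.aemeasurable

end Abstract

/-! ### The norm equivalences -/

variable {n : ℕ}

/-- Poincaré inequality on `D` in the direction `ε s` for functions vanishing on `Γ`. -/
def DirPoincare (D : Set (Space n)) (s : Sph n) (ε : ℝ) (Γ : Set (Space n)) : Prop :=
  ∀ u f : Space n → ℝ, ContDiffOn ℝ 1 u (closure D) → (∀ x ∈ Γ, u x = 0) →
    AEMeasurable f (domMeasure D) →
    (∀ᵐ x ∂(domMeasure D), u x * (ε * fderiv ℝ u x s) ≤ u x * f x) →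
    ∫⁻ x, ‖u x‖ₑ ^ 2 ∂(domMeasure D) ≤
      ENNReal.ofReal (4 * diam D ^ 2) * ∫⁻ x, ‖f x‖ₑ ^ 2 ∂(domMeasure D)

theorem dirPoincare_inflow {D : Set (Space n)} (hD : IsOpen D) (hc : Convex ℝ D)
    (hb : Bornology.IsBounded D) (s : Sph n) : DirPoincare D s 1 (inflow D s) := by
  intro u f hu hu0 hf h
  refine lintegral_sq_le_of_inflow hD hc hb s hu hu0 hf ?_
  simpa only [one_mul] using h

theorem dirPoincare_outflow {D : Set (Space n)} (hD : IsOpen D) (hc : Convex ℝ D)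
    (hb : Bornology.IsBounded D) (s : Sph n) : DirPoincare D s (-1) (outflow D s) := by
  intro u f hu hu0 hf h
  refine lintegral_sq_le_of_inflow hD hc hb (-s) hu (by rwa [inflow_neg]) hf ?_
  simpa using h

theorem fiber_l2Equiv {D : Set (Space n)} (hD : IsOpen D) {σ : Space n × Sph n → ℝ} {m M ε : ℝ}
    (hm : 0 ≤ m) (hε : |ε| = 1) {s : Sph n} (hs : GoodSection D σ m M s) {Γ : Set (Space n)}
    (hΓ : DirPoincare D s ε Γ)
    {p : FiberPair D} (hp : p ∈ fiberH0 D s Γ) :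
    L2Equiv (domMeasure D) (1 + (1 + |M|) * (2 * diam D))⁻¹ (1 + |M|)
      (fun x => ε * p.snd x + σ (x, s) * p.fst x) ‖p‖ := by
  refine l2Equiv_of_mem_closure (σ := fun x => σ (x, s)) (abs_nonneg M)
    (mul_nonneg two_pos.le diam_nonneg) hε hs.1 ?_ ?_ hp.2
  · filter_upwards [hs.2] with x hx
    rw [abs_of_nonneg (hm.trans hx.1)]
    exact hx.2.trans (le_abs_self M)
  · rintro q ⟨hqH, u, hu, hu0, hqu⟩
    have hder := snd_ae_eq_fderiv hD hqH (hu.mono subset_closure) hqu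
    have h1 : ∫⁻ x, ‖q.fst x‖ₑ ^ 2 ∂(domMeasure D) = ∫⁻ x, ‖u x‖ₑ ^ 2 ∂(domMeasure D) := by
      refine lintegral_congr_ae ?_
      filter_upwards [hqu] with x hx
      rw [hx]
    rw [h1, mul_pow, show (2 : ℝ) ^ 2 = 4 by norm_num]
    refine hΓ u _ hu hu0 ?_ ?_
    · exact ((Lp.aestronglyMeasurable q.snd).aemeasurable.const_mul ε).add
        (hs.1.mul (Lp.aestronglyMeasurable q.fst).aemeasurable)
    · filter_upwards [hqu, hder, hs.2] with x hx hx' hσ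
      rw [hx, hx', mul_add]
      -- The term `σ u²` is nonnegative and may be dropped, so no smallness of `σ` is needed.
      have := mul_nonneg (hm.trans hσ.1) (mul_self_nonneg (u x))
      linarith

/-- The directional inequality is applied to the slices of the C¹ representative `u`, with the slice
of the lifted operator as `f`. The slices of `q` itself need not be placed in the fiber spaces. -/
theorem phase_l2Equiv {D : Set (Space n)} (hD : IsOpen D) {σ : Space n × Sph n → ℝ} {m M ε : ℝ}
    (hm : 0 ≤ m) (hε : |ε| = 1) (hσm : AEMeasurable σ (phaseMeasure D))
    (hσ : ∀ᵐ z ∂(phaseMeasure D), m ≤ σ z ∧ σ z ≤ M) {Γ : Sph n → Set (Space n)}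
    (hΓ : ∀ s, DirPoincare D s ε (Γ s))
    {p : PhasePair D} (hp : p ∈ phaseH0 D Γ) :
    L2Equiv (phaseMeasure D) (1 + (1 + |M|) * (2 * diam D))⁻¹ (1 + |M|)
      (fun z => ε * p.snd z + σ z * p.fst z) ‖p‖ := by
  refine l2Equiv_of_mem_closure (abs_nonneg M)
    (mul_nonneg two_pos.le diam_nonneg) hε hσm ?_ ?_ hp.2
  · filter_upwards [hσ] with z hz
    rw [abs_of_nonneg (hm.trans hz.1)]
    exact hz.2.trans (le_abs_self M)
  · rintro q ⟨hqH, u, hu, hu0, hqu⟩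
    have hder := phase_snd_ae_eq_fderiv hD hqH
      (hu.mono (prod_mono subset_closure Subset.rfl)) hqu
    have h1 : ∫⁻ z, ‖q.fst z‖ₑ ^ 2 ∂(phaseMeasure D) = ∫⁻ z, ‖u z‖ₑ ^ 2 ∂(phaseMeasure D) := by
      refine lintegral_congr_ae ?_
      filter_upwards [hqu] with x hx
      rw [hx]
    have hum : AEMeasurable u (phaseMeasure D) :=
      (Lp.aestronglyMeasurable q.fst).aemeasurable.congr hqu
    have hfm : AEMeasurable (fun z => ε * q.snd z + σ z * q.fst z) (phaseMeasure D) :=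
      ((Lp.aestronglyMeasurable q.snd).aemeasurable.const_mul ε).add
        (hσm.mul (Lp.aestronglyMeasurable q.fst).aemeasurable)
    have hineq : ∀ᵐ z ∂(phaseMeasure D), u z * (ε * fderiv ℝ (fun x => u (x, z.2)) z.1 z.2) ≤
        u z * (ε * q.snd z + σ z * q.fst z) := by
      filter_upwards [hqu, hder, hσ] with z hz hz' hσz
      rw [hz, hz', mul_add]
      have := mul_nonneg (hm.trans hσz.1) (mul_self_nonneg (u z))
      linarith
    rw [h1, mul_pow, show (2 : ℝ) ^ 2 = 4 by norm_num]
    refine lintegral_prod_le_of_ae_section _ (hum.enorm.pow_const 2) (hfm.enorm.pow_const 2) ?_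
    filter_upwards [ae_aemeasurable_section hfm, ae_ae_swap hineq] with s hfs hs
    exact hΓ s (fun x => u (x, s)) (fun x => ε * q.snd (x, s) + σ (x, s) * q.fst (x, s))
      (contDiffOn_section hu s) (hu0 s) hfs hs

end Equiv

end Transport

end

theorem mainTheorem3 (m M L : ℝ) (hm : 0 ≤ m) :
    ∃ c C : ℝ, 0 < c ∧ 0 < C ∧
      ∀ (n : ℕ) (D : Set (Transport.Space n)), IsOpen D → Convex ℝ D → D.Nonempty →
        Bornology.IsBounded D → Metric.diam D = L →
      ∀ σ : Transport.Space n × Transport.Sph n → ℝ,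
        AEMeasurable σ (Transport.phaseMeasure D) →
        (∀ᵐ z ∂(Transport.phaseMeasure D), m ≤ σ z ∧ σ z ≤ M) →
        -- almost every direction is admissible
        (∀ᵐ s ∂(Transport.sphMeasure n), Transport.GoodSection D σ m M s) ∧
        -- if `σ` is measurable and the bounds hold everywhere on `D × S`, all directions are
        (Measurable σ → (∀ x ∈ D, ∀ s, m ≤ σ (x, s) ∧ σ (x, s) ≤ M) →
          ∀ s, Transport.GoodSection D σ m M s) ∧
        -- fiber equivalences in every admissible direction
        (∀ s : Transport.Sph n, Transport.GoodSection D σ m M s →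
          (∀ v ∈ Transport.fiberH0 D s (Transport.outflow D s),
            Transport.L2Equiv (Transport.domMeasure D) c C (Transport.fiberTadj σ s v) ‖v‖) ∧
          (∀ v ∈ Transport.fiberH0 D s (Transport.inflow D s),
            Transport.L2Equiv (Transport.domMeasure D) c C (Transport.fiberT σ s v) ‖v‖)) ∧
        -- lifted equivalences
        (∀ v ∈ Transport.phaseH0 D (Transport.outflow D),
          Transport.L2Equiv (Transport.phaseMeasure D) c C (Transport.phaseTadj σ v) ‖v‖) ∧
        (∀ v ∈ Transport.phaseH0 D (Transport.inflow D),
          Transport.L2Equiv (Transport.phaseMeasure D) c C (Transport.phaseT σ v) ‖v‖) := by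
  have hL : 0 ≤ |L| := abs_nonneg L
  -- Absolute values keep both constants positive for all real `M` and `L`, including values for
  -- which no `D` or `σ` exists.
  refine ⟨(1 + (1 + |M|) * (2 * |L|))⁻¹, 1 + |M|, by positivity, by positivity, ?_⟩
  intro n D hD hc _ hb hdiam σ hσm hσ
  have hLd : |L| = Metric.diam D := by rw [← hdiam, abs_of_nonneg Metric.diam_nonneg]
  rw [hLd]
  have hin := Transport.dirPoincare_inflow hD hc hb
  have hout := Transport.dirPoincare_outflow hD hc hb
  have hone : |(1 : ℝ)| = 1 := abs_one
  have hneg : |(-1 : ℝ)| = 1 := by simp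
  refine ⟨?_, fun hσM hσb s => ⟨?_, ?_⟩, fun s hs => ⟨fun v hv => ?_, fun v hv => ?_⟩,
    fun v hv => ?_, fun v hv => ?_⟩
  · filter_upwards [Transport.ae_aemeasurable_section hσm, Transport.ae_ae_swap hσ] with s h1 h2
    exact ⟨h1, h2⟩
  · exact (hσM.comp measurable_prodMk_right).aemeasurable
  · exact MeasureTheory.ae_restrict_of_forall_mem hD.measurableSet fun x hx => hσb x hx s
  · convert Transport.fiber_l2Equiv hD hm hneg hs (hout s) hv using 1
    funext x
    simp only [Transport.fiberTadj]
    ring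
  · convert Transport.fiber_l2Equiv hD hm hone hs (hin s) hv using 1
    funext x
    simp only [Transport.fiberT]
    ring
  · convert Transport.phase_l2Equiv hD hm hneg hσm hσ hout hv using 1
    funext z
    simp only [Transport.phaseTadj]
    ring
  · convert Transport.phase_l2Equiv hD hm hone hσm hσ hin hv using 1
    funext z
    simp only [Transport.phaseT]
    ring
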